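/- Let $v\in\mathcal S(\mathbb R^3;\mathbb R)$ be even, $\beta\in\mathbb R$, $N\ge 1$ an integer, and $v_N(x)=N^{3\beta}v(N^\beta x)$. Let $I\subset\mathbb R$ be an interval with more than one point. For $t\in I$ let $\phi(t,\cdot)\in L^2(\mathbb R^3;\mathbb C)$ and let $k(t,x,y)$ be a symmetric complex kernel in $L^2(\mathbb R^3\times\mathbb R^3)$ with $k(t,x,\cdot)\in L^2(\mathbb R^3)$ for every $x$. Notation: $(A\circ B)(x,y)=\int A(x,z)B(z,y)\,dz$; $A^T(x,y)=A(y,x)$; $\mathrm{Tr}A(x)=A(x,x)$; $(v_NA)(x,y)=v_N(x-y)A(x,y)$; a bar denotes the complex conjugate; the variable $t$ is often suppressed. Put $$\mathrm{sh}(k)=k+\tfrac1{3!}\,k\circ\bar k\circ k+\cdots,\qquad \mathrm{ch}(k)=\delta(x-y)+\tfrac1{2!}\,\bar k\circ k+\tfrac1{4!}\,\bar k\circ k\circ\bar k\circ k+\cdots,$$ $$\Lambda(x_1,x_2)=\tfrac1{2N}\mathrm{sh}(2k)(x_1,x_2)+\phi(x_1)\phi(x_2),\qquad \Gamma(x_1,x_2)=\tfrac1N\big(\overline{\mathrm{sh}(k)}\circ\mathrm{sh}(k)\big)(x_1,x_2)+\bar\phi(x_1)\phi(x_2),$$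 $$\tilde g_N(x,y)=-\Delta_x\delta(x-y)+(v_N*\mathrm{Tr}\,\Gamma)(x)\,\delta(x-y)+v_N(x-y)\Gamma(x,y),$$ $$\tilde{\mathbf S}(s)=\tfrac1i s_t+\tilde g_N^T\circ s+s\circ\tilde g_N,\qquad \tilde{\mathbf W}(p)=\tfrac1i p_t+[\tilde g_N^T,p].$$ **Theorem.** The coupled equations for $(\phi,k)$ $$\tfrac1i\partial_t\phi-\Delta\phi+\int v_N(x-y)\Lambda(x,y)\bar\phi(y)\,dy+\tfrac1N\big(v_N*\mathrm{Tr}(\mathrm{sh}(k)\circ\overline{\mathrm{sh}(k)})\big)\phi+\tfrac1N\int v_N(x-y)\big(\mathrm{sh}(k)\circ\overline{\mathrm{sh}(k)}\big)(x,y)\phi(y)\,dy=0,$$ $$\tilde{\mathbf S}(\mathrm{sh}(2k))+(v_N\Lambda)\circ\mathrm{ch}(2k)+\overline{\mathrm{ch}(2k)}\circ(v_N\Lambda)=0,$$ $$\tilde{\mathbf W}(\overline{\mathrm{ch}(2k)})+(v_N\Lambda)\circ\overline{\mathrm{sh}(2k)}-\mathrm{sh}(2k)\circ\overline{(v_N\Lambda)}=0$$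 hold on $I$ if and only if $\phi$, $\Lambda$, $\Gamma$ satisfy on $I$ the closed system $$\Big\{\tfrac1i\partial_t-\Delta_{x_1}\Big\}\phi(x_1)=-\int v_N(x_1-y)\Gamma(y,y)\,dy\;\phi(x_1)$$ $$\quad-\int\Big\{v_N(x_1-y)\phi(y)\big(\Gamma(y,x_1)-\bar\phi(y)\phi(x_1)\big)+v_N(x_1-y)\bar\phi(y)\big(\Lambda(x_1,y)-\phi(x_1)\phi(y)\big)\Big\}dy,$$ $$\Big\{\tfrac1i\partial_t-\Delta_{x_1}-\Delta_{x_2}+\tfrac1N v_N(x_1-x_2)\Big\}\Lambda(x_1,x_2)=-\int\big\{v_N(x_1-y)\Gamma(y,y)+v_N(x_2-y)\Gamma(y,y)\big\}dy\;\Lambda(x_1,x_2)$$ $$\quad-\int\big(v_N(x_1-y)+v_N(x_2-y)\big)\big(\Lambda(x_1,y)\Gamma(y,x_2)+\bar\Gamma(x_1,y)\Lambda(y,x_2)\big)dy$$ $$\quad+2\int\big(v_N(x_1-y)+v_N(x_2-y)\big)|\phi(y)|^2\phi(x_1)\phi(x_2)\,dy,$$ $$\Big\{\tfrac1i\partial_t-\Delta_{x_1}+\Delta_{x_2}\Big\}\bar\Gamma(x_1,x_2)=-\int\big(v_N(x_1-y)-v_N(x_2-y)\big)\Lambda(x_1,y)\bar\Lambda(y,x_2)\,dy$$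 $$\quad-\int\big(v_N(x_1-y)-v_N(x_2-y)\big)\big(\bar\Gamma(x_1,y)\bar\Gamma(y,x_2)+\bar\Gamma(y,y)\bar\Gamma(x_1,x_2)\big)dy$$ $$\quad+2\int\big(v_N(x_1-y)-v_N(x_2-y)\big)|\phi(y)|^2\phi(x_1)\bar\phi(x_2)\,dy.$$ Here each system is understood in the classical sense: the unknowns that are differentiated in it ($\phi$, $\mathrm{sh}(2k)$, $\overline{\mathrm{ch}(2k)}-\delta$ in the first; $\phi$, $\Lambda$, $\bar\Gamma$ in the second) are differentiable in $t\in I$ (one-sidedly at an end point of $I$) and twice continuously differentiable in the space variables, and the equations hold at all $t\in I$ and all points of space. -/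

import Mathlib

open scoped SchwartzMap

namespace PairExcitation

noncomputable section

open MeasureTheory
open scoped ComplexConjugate

/-- Physical space `ℝ³` with its Euclidean norm and Lebesgue measure. -/
abbrev E3 : Type := EuclideanSpace ℝ (Fin 3)

/-- Integral kernels `A(x, y)` on `ℝ³ × ℝ³`. -/
abbrev Ker : Type := E3 → E3 → ℂ

/-! ### Kernel algebra -/

/-- Pointwise complex conjugate `Ā(x, y)`. -/
def conjK (A : Ker) : Ker := fun x y => conj (A x y)

/-- Transpose `Aᵀ(x, y) = A(y, x)`. -/
def transp (A : Ker) : Ker := fun x y => A y x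

/-- Composition `(A ∘ B)(x, y) = ∫ A(x, z) B(z, y) dz`. -/
def comp (A B : Ker) : Ker := fun x y => ∫ z, A x z * B z y

/-- `w(x - y) A(x, y)`, the pointwise product of an interaction potential and a kernel. -/
def potMul (w : E3 → ℝ) (A : Ker) : Ker := fun x y => (w (x - y) : ℂ) * A x y

/-- `(w * Tr A)(x) = ∫ w(x - y) A(y, y) dy`, where `Tr A (y) = A(y, y)` is the trace density. -/
def convTr (w : E3 → ℝ) (A : Ker) : E3 → ℂ := fun x => ∫ y, (w (x - y) : ℂ) * A y y

/-! ### The kernels `sh(k)` and `ch(k)` -/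

/-- `(k ∘ k̄)ⁿ ∘ k`. -/
def shTerm (k : Ker) : ℕ → Ker
  | 0 => k
  | n + 1 => comp (comp k (conjK k)) (shTerm k n)

/-- `sh(k) = k + (1/3!) k ∘ k̄ ∘ k + (1/5!) k ∘ k̄ ∘ k ∘ k̄ ∘ k + ⋯`. -/
def sh (k : Ker) : Ker := fun x y => ∑' n : ℕ, ((Nat.factorial (2 * n + 1) : ℕ) : ℂ)⁻¹ * shTerm k n x y

/-- `(k̄ ∘ k)ⁿ⁺¹`. -/
def chTerm (k : Ker) : ℕ → Ker
  | 0 => comp (conjK k) k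
  | n + 1 => comp (comp (conjK k) k) (chTerm k n)

/-- The regular part `p(k)` of `ch(k) = δ(x - y) + p(k)`, that is
`p(k) = (1/2!) k̄ ∘ k + (1/4!) k̄ ∘ k ∘ k̄ ∘ k + ⋯`. -/
def chReg (k : Ker) : Ker := fun x y => ∑' n : ℕ, ((Nat.factorial (2 * n + 2) : ℕ) : ℂ)⁻¹ * chTerm k n x y

/-- `A ∘ (δ + p)`. -/
def compDeltaAdd (A p : Ker) : Ker := fun x y => A x y + comp A p x y

/-- `(δ + p) ∘ A`. -/
def deltaAddComp (p A : Ker) : Ker := fun x y => A x y + comp p A x y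

/-- The kernel `2k`. -/
def twice (k : Ker) : Ker := fun x y => 2 * k x y

/-! ### The interaction and the matrices `Λ`, `Γ` -/

/-- `v_N(x) = N^{3β} v(N^β x)`. -/
def vN (v : 𝓢(E3, ℝ)) (β : ℝ) (N : ℕ) : E3 → ℝ :=
  fun x => (N : ℝ) ^ (3 * β) * v ((N : ℝ) ^ β • x)

/-- `Λ(x₁, x₂) = (1/2N) sh(2k)(x₁, x₂) + φ(x₁) φ(x₂)`. -/
def Lam (N : ℕ) (φ : E3 → ℂ) (k : Ker) : Ker :=
  fun x₁ x₂ => 1 / (2 * (N : ℂ)) * sh (twice k) x₁ x₂ + φ x₁ * φ x₂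

/-- `Γ(x₁, x₂) = (1/N) (sh(k)‾ ∘ sh(k))(x₁, x₂) + φ̄(x₁) φ(x₂)`. -/
def Gam (N : ℕ) (φ : E3 → ℂ) (k : Ker) : Ker :=
  fun x₁ x₂ => 1 / (N : ℂ) * comp (conjK (sh k)) (sh k) x₁ x₂ + conj (φ x₁) * φ x₂

/-! ### Differential operators and classical regularity -/

/-- `Δ` acting on the first variable of a kernel. -/
def lap₁ (A : Ker) : Ker := fun x y => Laplacian.laplacian (fun z => A z y) x

/-- `Δ` acting on the second variable of a kernel. -/
def lap₂ (A : Ker) : Ker := fun x y => Laplacian.laplacian (fun z => A x z) y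

/-- `(1/i) ∂_t f` for a function of time defined on the time interval `I`
(one-sided derivative at an end point that belongs to `I`). -/
def Dt (I : Set ℝ) (f : ℝ → ℂ) (t : ℝ) : ℂ := 1 / Complex.I * derivWithin f I t

/-- `φ(t, x)` has the derivatives that a Schrödinger equation on `I × ℝ³` involves: it is
differentiable in `t` and twice continuously differentiable in `x`. -/
def RegularField (I : Set ℝ) (φ : ℝ → E3 → ℂ) : Prop :=
  (∀ t ∈ I, ∀ x, DifferentiableWithinAt ℝ (fun s => φ s x) I t) ∧
  (∀ t ∈ I, ContDiff ℝ 2 (φ t))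

/-- `A(t, x, y)` has the derivatives that a Schrödinger equation on `I × ℝ³ × ℝ³` involves:
it is differentiable in `t` and twice continuously differentiable in `(x, y)`. -/
def RegularKer (I : Set ℝ) (A : ℝ → Ker) : Prop :=
  (∀ t ∈ I, ∀ x y, DifferentiableWithinAt ℝ (fun s => A s x y) I t) ∧
  (∀ t ∈ I, ContDiff ℝ 2 (fun q : E3 × E3 => A t q.1 q.2))

/-! ### The coupled equations for `(φ, k)`

With `g̃(x, y) = -Δ_x δ(x - y) + (w * Tr Γ)(x) δ(x - y) + w(x - y) Γ(x, y)`. -/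

/-- `g̃ᵀ ∘ s`. -/
def gTComp (w : E3 → ℝ) (Γ s : Ker) : Ker := fun x y =>
  -lap₁ s x y + convTr w Γ x * s x y + comp (transp (potMul w Γ)) s x y

/-- `s ∘ g̃`. -/
def compG (w : E3 → ℝ) (Γ s : Ker) : Ker := fun x y =>
  -lap₂ s x y + s x y * convTr w Γ y + comp s (potMul w Γ) x y

/-- `s ∘ g̃ᵀ`. -/
def compGT (w : E3 → ℝ) (Γ s : Ker) : Ker := fun x y =>
  -lap₂ s x y + s x y * convTr w Γ y + comp s (transp (potMul w Γ)) x y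

/-- `S̃(s) = (1/i) s_t + g̃ᵀ ∘ s + s ∘ g̃`. -/
def STilde (I : Set ℝ) (w : E3 → ℝ) (Γ s : ℝ → Ker) (t : ℝ) : Ker := fun x y =>
  Dt I (fun τ => s τ x y) t + gTComp w (Γ t) (s t) x y + compG w (Γ t) (s t) x y

/-- `W̃(p) = (1/i) p_t + [g̃ᵀ, p]`. Since `δ(x - y)` is constant in time and commutes with `g̃ᵀ`,
this is also the value of `W̃` at `δ + p`. -/
def WTilde (I : Set ℝ) (w : E3 → ℝ) (Γ p : ℝ → Ker) (t : ℝ) : Ker := fun x y =>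
  Dt I (fun τ => p τ x y) t + (gTComp w (Γ t) (p t) x y - compGT w (Γ t) (p t) x y)

/-- The equation for the condensate `φ` in terms of `(φ, k)`, on the time interval `I`. -/
def CondensateEq (I : Set ℝ) (w : E3 → ℝ) (N : ℕ) (φ : ℝ → E3 → ℂ) (k : ℝ → Ker) : Prop :=
  RegularField I φ ∧ ∀ t ∈ I, ∀ x : E3,
    Dt I (fun τ => φ τ x) t - Laplacian.laplacian (φ t) x
      + (∫ y, (w (x - y) : ℂ) * Lam N (φ t) (k t) x y * conj (φ t y))
      + 1 / (N : ℂ) * convTr w (comp (sh (k t)) (conjK (sh (k t)))) x * φ t x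
      + 1 / (N : ℂ) *
          (∫ y, (w (x - y) : ℂ) * comp (sh (k t)) (conjK (sh (k t))) x y * φ t y) = 0

/-- `S̃(sh(2k)) + (wΛ) ∘ ch(2k) + ch(2k)‾ ∘ (wΛ) = 0`. -/
def PairEqS (I : Set ℝ) (w : E3 → ℝ) (N : ℕ) (φ : ℝ → E3 → ℂ) (k : ℝ → Ker) : Prop :=
  RegularKer I (fun t => sh (twice (k t))) ∧ ∀ t ∈ I, ∀ x y : E3,
    STilde I w (fun τ => Gam N (φ τ) (k τ)) (fun τ => sh (twice (k τ))) t x y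
      + compDeltaAdd (potMul w (Lam N (φ t) (k t))) (chReg (twice (k t))) x y
      + deltaAddComp (conjK (chReg (twice (k t)))) (potMul w (Lam N (φ t) (k t))) x y = 0

/-- `W̃(ch(2k)‾) + (wΛ) ∘ sh(2k)‾ - sh(2k) ∘ (wΛ)‾ = 0`. -/
def PairEqW (I : Set ℝ) (w : E3 → ℝ) (N : ℕ) (φ : ℝ → E3 → ℂ) (k : ℝ → Ker) : Prop :=
  RegularKer I (fun t => conjK (chReg (twice (k t)))) ∧ ∀ t ∈ I, ∀ x y : E3,
    WTilde I w (fun τ => Gam N (φ τ) (k τ)) (fun τ => conjK (chReg (twice (k τ)))) t x y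
      + comp (potMul w (Lam N (φ t) (k t))) (conjK (sh (twice (k t)))) x y
      - comp (sh (twice (k t))) (conjK (potMul w (Lam N (φ t) (k t)))) x y = 0

/-! ### The closed system for `(φ, Λ, Γ)` -/

/-- The Schrödinger equation for `φ` in the closed system. -/
def EvPhi (I : Set ℝ) (w : E3 → ℝ) (φ : ℝ → E3 → ℂ) (Λ Γ : ℝ → Ker) : Prop :=
  RegularField I φ ∧ ∀ t ∈ I, ∀ x₁ : E3,
    Dt I (fun τ => φ τ x₁) t - Laplacian.laplacian (φ t) x₁
      = -(∫ y, (w (x₁ - y) : ℂ) * Γ t y y) * φ t x₁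
        - ∫ y, ((w (x₁ - y) : ℂ) * φ t y * (Γ t y x₁ - conj (φ t y) * φ t x₁)
            + (w (x₁ - y) : ℂ) * conj (φ t y) * (Λ t x₁ y - φ t x₁ * φ t y))

/-- The Schrödinger equation for `Λ` in the closed system. -/
def EvLambda (I : Set ℝ) (w : E3 → ℝ) (N : ℕ) (φ : ℝ → E3 → ℂ) (Λ Γ : ℝ → Ker) : Prop :=
  RegularKer I Λ ∧ ∀ t ∈ I, ∀ x₁ x₂ : E3,
    Dt I (fun τ => Λ τ x₁ x₂) t - lap₁ (Λ t) x₁ x₂ - lap₂ (Λ t) x₁ x₂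
        + 1 / (N : ℂ) * (w (x₁ - x₂) : ℂ) * Λ t x₁ x₂
      = -(∫ y, ((w (x₁ - y) : ℂ) * Γ t y y + (w (x₂ - y) : ℂ) * Γ t y y)) * Λ t x₁ x₂
        - (∫ y, ((w (x₁ - y) : ℂ) + (w (x₂ - y) : ℂ)) *
            (Λ t x₁ y * Γ t y x₂ + conj (Γ t x₁ y) * Λ t y x₂))
        + 2 * ∫ y, ((w (x₁ - y) : ℂ) + (w (x₂ - y) : ℂ)) *
            ((‖φ t y‖ ^ 2 : ℝ) : ℂ) * φ t x₁ * φ t x₂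

/-- The Schrödinger equation for `Γ̄` in the closed system. -/
def EvGamma (I : Set ℝ) (w : E3 → ℝ) (φ : ℝ → E3 → ℂ) (Λ Γ : ℝ → Ker) : Prop :=
  RegularKer I (fun t => conjK (Γ t)) ∧ ∀ t ∈ I, ∀ x₁ x₂ : E3,
    Dt I (fun τ => conj (Γ τ x₁ x₂)) t
        - lap₁ (conjK (Γ t)) x₁ x₂ + lap₂ (conjK (Γ t)) x₁ x₂
      = -(∫ y, ((w (x₁ - y) : ℂ) - (w (x₂ - y) : ℂ)) * (Λ t x₁ y * conj (Λ t y x₂)))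
        - (∫ y, ((w (x₁ - y) : ℂ) - (w (x₂ - y) : ℂ)) *
            (conj (Γ t x₁ y) * conj (Γ t y x₂) + conj (Γ t y y) * conj (Γ t x₁ x₂)))
        + 2 * ∫ y, ((w (x₁ - y) : ℂ) - (w (x₂ - y) : ℂ)) *
            ((‖φ t y‖ ^ 2 : ℝ) : ℂ) * φ t x₁ * conj (φ t x₂)

/-! ### Kernels of pair excitations -/

/-- `k` is a symmetric Hilbert–Schmidt kernel on `ℝ³` each of whose slices `k(x, ·)` is square
integrable, so that the compositions of `k` and `k̄` are given by convergent integrals at every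
point. -/
structure IsPairKernel (k : Ker) : Prop where
  symm : ∀ x y, k x y = k y x
  sq_integrable : MemLp (fun q : E3 × E3 => k q.1 q.2) 2 (volume.prod volume)
  slice_sq_integrable : ∀ x, MemLp (k x) 2 volume

end

end PairExcitation

open PairExcitation MeasureTheory

namespace PairExcitation

noncomputable section

open scoped ComplexConjugate

/-! Put `c = 1/(2N)`, `u = sh(2k)` and `p = ch(2k) - δ`. By definition `Λ = c u + φ ⊗ φ`, and the
double-angle identity `cosh 2x - 1 = 2 sinh² x`, valid for kernels (`chReg_twice`), gives `Γ = c p +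
φ̄ ⊗ φ`. So both systems concern the same quantities up to an affine change of unknown.

Inserting these forms into the interaction integrals (`Lam_interaction`, `Gam_interaction`)
separates `c` times the interaction in the pair equations from products of `φ` or `φ̄` with the
force that drives the condensate. The quartic terms in `φ` cancel against the last integral of the
closed equations. The two equations for `φ` have the same force (`phi_interaction`,
`condensate_interaction`). Hence, by the product rule, the closed equation for `Λ` is `c` times the
pair equation plus the condensate equation at `x₁` times `φ(x₂)` and at `x₂` times `φ(x₁)`. For `Γ̄`
the second variable carries the conjugate equation. Since `c ≠ 0`, the pair equations are equivalent
to the closed ones once the condensate equation holds.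

The equations are read at every point, so compositions, associativity and the series need control on
every slice, not only almost everywhere. This is the role of `IsHSKernel`. -/

/-! ### Hilbert–Schmidt kernels with square integrable slices -/

/-- Hilbert–Schmidt kernels all of whose rows and columns are square integrable. Such kernels can
be composed pointwise. -/
structure IsHSKernel (A : Ker) : Prop where
  prod : MemLp (fun q : E3 × E3 => A q.1 q.2) 2 (volume.prod volume)
  row : ∀ x, MemLp (A x) 2 volume
  col : ∀ y, MemLp (fun x => A x y) 2 volume

/-- The `L²` norm of the row `A(x, ·)`. -/
def rowNorm (A : Ker) (x : E3) : ℝ := √(∫ z, ‖A x z‖ ^ 2)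

/-- The `L²` norm of the column `A(·, y)`. -/
def colNorm (A : Ker) (y : E3) : ℝ := √(∫ z, ‖A z y‖ ^ 2)

/-- The Hilbert–Schmidt norm of a kernel. -/
def hsNorm (A : Ker) : ℝ := √(∫ x, rowNorm A x ^ 2)

lemma rowNorm_nonneg (A : Ker) (x : E3) : 0 ≤ rowNorm A x := Real.sqrt_nonneg _

lemma colNorm_nonneg (A : Ker) (y : E3) : 0 ≤ colNorm A y := Real.sqrt_nonneg _

lemma hsNorm_nonneg (A : Ker) : 0 ≤ hsNorm A := Real.sqrt_nonneg _

lemma rowNorm_sq (A : Ker) (x : E3) : rowNorm A x ^ 2 = ∫ z, ‖A x z‖ ^ 2 :=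
  Real.sq_sqrt (integral_nonneg fun _ => by positivity)

lemma hsNorm_sq (A : Ker) : hsNorm A ^ 2 = ∫ x, rowNorm A x ^ 2 :=
  Real.sq_sqrt (integral_nonneg fun _ => by positivity)

lemma memLp_two_mul_prod {f g : E3 → ℂ} (hf : MemLp f 2 volume) (hg : MemLp g 2 volume) :
    MemLp (fun q : E3 × E3 => f q.1 * g q.2) 2 (volume.prod volume) := by
  refine (memLp_two_iff_integrable_sq_norm (hf.1.comp_fst.mul hg.1.comp_snd)).2 ?_
  refine (((memLp_two_iff_integrable_sq_norm hf.1).1 hf).mul_prod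
    ((memLp_two_iff_integrable_sq_norm hg.1).1 hg)).congr (.of_forall fun q => ?_)
  simp [mul_pow]

lemma norm_integral_mul_le {f g : E3 → ℂ} (hf : MemLp f 2 volume) (hg : MemLp g 2 volume) :
    ‖∫ z, f z * g z‖ ≤ √(∫ z, ‖f z‖ ^ 2) * √(∫ z, ‖g z‖ ^ 2) := by
  have h := integral_mul_norm_le_Lp_mul_Lq (μ := (volume : Measure E3)) (f := f) (g := g)
    Real.HolderConjugate.two_two (by simpa using hf) (by simpa using hg)
  refine (norm_integral_le_integral_norm _).trans ?_
  simpa [Real.sqrt_eq_rpow] using h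

namespace IsHSKernel

variable {A B C : Ker}

lemma transp (hA : IsHSKernel A) : IsHSKernel (transp A) where
  prod := hA.prod.comp_measurePreserving Measure.measurePreserving_swap
  row := hA.col
  col := hA.row

lemma conjK (hA : IsHSKernel A) : IsHSKernel (conjK A) where
  prod := hA.prod.star
  row x := (hA.row x).star
  col y := (hA.col y).star

lemma add (hA : IsHSKernel A) (hB : IsHSKernel B) : IsHSKernel fun x y => A x y + B x y where
  prod := hA.prod.add hB.prod
  row x := (hA.row x).add (hB.row x)
  col y := (hA.col y).add (hB.col y)

lemma const_mul (hA : IsHSKernel A) (c : ℂ) : IsHSKernel fun x y => c * A x y where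
  prod := hA.prod.const_mul c
  row x := (hA.row x).const_mul c
  col y := (hA.col y).const_mul c

lemma mul {f g : E3 → ℂ} (hf : MemLp f 2 volume) (hg : MemLp g 2 volume) :
    IsHSKernel fun x y => f x * g y where
  prod := memLp_two_mul_prod hf hg
  row x := hg.const_mul (f x)
  col y := hf.mul_const (g y)

lemma integrable_mul (hA : IsHSKernel A) (hB : IsHSKernel B) (x y : E3) :
    Integrable fun z => A x z * B z y :=
  (hA.row x).integrable_mul (hB.col y)

lemma memLp_rowNorm (hA : IsHSKernel A) : MemLp (fun x => (rowNorm A x : ℂ)) 2 volume := by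
  have hint := (memLp_two_iff_integrable_sq_norm hA.prod.1).1 hA.prod
  have hm : AEStronglyMeasurable (fun x => (rowNorm A x : ℂ)) volume :=
    Complex.continuous_ofReal.comp_aestronglyMeasurable
      (Real.continuous_sqrt.comp_aestronglyMeasurable hint.1.integral_prod_right')
  rw [memLp_two_iff_integrable_sq_norm hm]
  refine hint.integral_prod_left.congr (.of_forall fun x => ?_)
  simp [rowNorm_sq]

lemma memLp_colNorm (hA : IsHSKernel A) : MemLp (fun x => (colNorm A x : ℂ)) 2 volume :=
  hA.transp.memLp_rowNorm

lemma norm_comp_le (hA : IsHSKernel A) (hB : IsHSKernel B) (x y : E3) :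
    ‖PairExcitation.comp A B x y‖ ≤ rowNorm A x * colNorm B y :=
  norm_integral_mul_le (hA.row x) (hB.col y)

/-- A measurable kernel dominated by a Hilbert–Schmidt kernel with square integrable slices. -/
lemma of_le (hB : IsHSKernel B)
    (hm : AEStronglyMeasurable (fun q : E3 × E3 => A q.1 q.2) (volume.prod volume))
    (hr : ∀ x, AEStronglyMeasurable (A x) volume)
    (hc : ∀ y, AEStronglyMeasurable (fun x => A x y) volume)
    (h : ∀ x y, ‖A x y‖ ≤ ‖B x y‖) : IsHSKernel A where
  prod := hB.prod.of_le hm (.of_forall fun _ => h _ _)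
  row x := (hB.row x).of_le (hr x) (.of_forall fun _ => h _ _)
  col y := (hB.col y).of_le (hc y) (.of_forall fun _ => h _ _)

/-- Cauchy–Schwarz bounds the composition by the rank-one kernel `rowNorm A x * colNorm B y`, whose
factors are in `L²`. Measurability, on the product and on each slice, comes from Fubini. -/
lemma comp (hA : IsHSKernel A) (hB : IsHSKernel B) : IsHSKernel (comp A B) := by
  refine of_le (mul hA.memLp_rowNorm hB.memLp_colNorm) ?_ (fun x => ?_) (fun y => ?_) fun x y => ?_
  · have h1 : AEStronglyMeasurable (fun p : (E3 × E3) × E3 => A p.1.1 p.2)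
        ((volume.prod volume).prod volume) :=
      hA.prod.1.comp_quasiMeasurePreserving
        (QuasiMeasurePreserving.prodMap Measure.quasiMeasurePreserving_fst
          (Measure.QuasiMeasurePreserving.id volume))
    have h2 : AEStronglyMeasurable (fun p : (E3 × E3) × E3 => B p.2 p.1.2)
        ((volume.prod volume).prod volume) :=
      hB.transp.prod.1.comp_quasiMeasurePreserving
        (QuasiMeasurePreserving.prodMap Measure.quasiMeasurePreserving_snd
          (Measure.QuasiMeasurePreserving.id volume))
    exact (h1.mul h2).integral_prod_right'
  · exact ((hA.row x).1.comp_snd.mul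
      (hB.transp.prod.1 : AEStronglyMeasurable _ _)).integral_prod_right'
  · exact ((hA.prod.1).mul ((hB.col y).1.comp_snd)).integral_prod_right'
  · simpa [abs_of_nonneg, rowNorm_nonneg, colNorm_nonneg] using hA.norm_comp_le hB x y

/-- Only the left factor pays its Hilbert–Schmidt norm. Iteration therefore gives geometric growth
with the column norm of the last factor kept fixed. -/
lemma colNorm_comp_le (hA : IsHSKernel A) (hB : IsHSKernel B) (y : E3) :
    colNorm (PairExcitation.comp A B) y ≤ hsNorm A * colNorm B y := by
  refine Real.sqrt_le_iff.2 ⟨mul_nonneg (hsNorm_nonneg _) (colNorm_nonneg _ _), ?_⟩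
  have hrow := (memLp_two_iff_integrable_sq_norm hA.memLp_rowNorm.1).1 hA.memLp_rowNorm
  have hcol := (memLp_two_iff_integrable_sq_norm ((hA.comp hB).col y).1).1 ((hA.comp hB).col y)
  rw [mul_pow, hsNorm_sq, ← integral_mul_const]
  refine integral_mono hcol
    ((hrow.mul_const (colNorm B y ^ 2)).congr (.of_forall fun x => ?_)) fun x => ?_
  · simp
  · rw [← mul_pow]
    exact pow_le_pow_left₀ (norm_nonneg _) (hA.norm_comp_le hB x y) 2

lemma integrable_diag_comp (hA : IsHSKernel A) (hB : IsHSKernel B) :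
    Integrable fun y => PairExcitation.comp A B y y :=
  (hA.prod.integrable_mul hB.transp.prod).integral_prod_left

/-- Composition of kernels is associative at every point. -/
lemma comp_assoc (hA : IsHSKernel A) (hB : IsHSKernel B) (hC : IsHSKernel C) :
    PairExcitation.comp (PairExcitation.comp A B) C
      = PairExcitation.comp A (PairExcitation.comp B C) := by
  funext x y
  have hint : Integrable (Function.uncurry fun z w => A x w * B w z * C z y)
      (volume.prod volume) := by
    -- With the end points fixed, the outer factors form a tensor product in `L²(ℝ³ × ℝ³)`, paired
    -- with the Hilbert–Schmidt kernel in the middle.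
    refine ((memLp_two_mul_prod (hC.col y) (hA.row x)).integrable_mul hB.transp.prod).congr
      (.of_forall fun q => ?_)
    simp only [Pi.mul_apply, PairExcitation.transp, Function.uncurry]
    ring
  simp only [PairExcitation.comp]
  simp_rw [← integral_mul_const, ← integral_const_mul]
  rw [integral_integral_swap hint]
  simp_rw [mul_assoc]

end IsHSKernel

lemma transp_comp (A B : Ker) : transp (comp A B) = comp (transp B) (transp A) := by
  funext x y
  simp only [transp, comp]
  simp_rw [mul_comm]

lemma conjK_comp (A B : Ker) : conjK (comp A B) = comp (conjK A) (conjK B) := by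
  funext x y
  simp only [conjK, comp, ← integral_conj, map_mul]

lemma conjK_conjK (A : Ker) : conjK (conjK A) = A := by
  funext x y
  simp [conjK]

/-! ### The series defining `sh(k)` and `ch(k)` -/

lemma IsPairKernel.isHSKernel {k : Ker} (hk : IsPairKernel k) : IsHSKernel k where
  prod := hk.sq_integrable
  row := hk.slice_sq_integrable
  col y := by simpa only [hk.symm _ y] using hk.slice_sq_integrable y

lemma IsPairKernel.twice {k : Ker} (hk : IsPairKernel k) : IsPairKernel (twice k) where
  symm x y := by simp only [PairExcitation.twice, hk.symm x y]
  sq_integrable := (hk.isHSKernel.const_mul 2).prod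
  slice_sq_integrable := (hk.isHSKernel.const_mul 2).row

lemma IsHSKernel.shTerm {k : Ker} (hk : IsHSKernel k) : ∀ n, IsHSKernel (shTerm k n)
  | 0 => hk
  | n + 1 => (hk.comp hk.conjK).comp (IsHSKernel.shTerm hk n)

/-- A kernel that dominates all the terms of `sh(k)`, up to geometric factors. -/
def shBound (k : Ker) : Ker := fun x y =>
  (‖k x y‖ : ℂ) + (rowNorm (comp k (conjK k)) x : ℂ) * (colNorm k y : ℂ)

lemma isHSKernel_shBound {k : Ker} (hk : IsHSKernel k) : IsHSKernel (shBound k) :=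
  IsHSKernel.add ⟨hk.prod.norm.ofReal, fun x => (hk.row x).norm.ofReal,
    fun y => (hk.col y).norm.ofReal⟩
    (.mul (hk.comp hk.conjK).memLp_rowNorm hk.memLp_colNorm)

lemma norm_shBound (k : Ker) (x y : E3) :
    ‖shBound k x y‖ = ‖k x y‖ + rowNorm (comp k (conjK k)) x * colNorm k y := by
  rw [shBound, ← Complex.ofReal_mul, ← Complex.ofReal_add, Complex.norm_real, Real.norm_of_nonneg]
  have := mul_nonneg (rowNorm_nonneg (comp k (conjK k)) x) (colNorm_nonneg k y)
  positivity

lemma colNorm_shTerm_le {k : Ker} (hk : IsHSKernel k) (n : ℕ) (y : E3) :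
    colNorm (shTerm k n) y ≤ hsNorm (comp k (conjK k)) ^ n * colNorm k y := by
  induction n with
  | zero => simp [shTerm]
  | succ n ih =>
    refine ((hk.comp hk.conjK).colNorm_comp_le (hk.shTerm n) y).trans ?_
    rw [pow_succ', mul_assoc]
    exact mul_le_mul_of_nonneg_left ih (hsNorm_nonneg _)

/-- For `n ≥ 1` the outermost `k ∘ k̄` contributes its row norm and the remaining word its column
norm. The summand `‖k‖` of `shBound` serves `n = 0`; the base `1 + hsNorm` is at least `1`, so spare
powers only enlarge the bound. -/
lemma norm_shTerm_le {k : Ker} (hk : IsHSKernel k) (n : ℕ) (x y : E3) :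
    ‖shTerm k n x y‖ ≤ (1 + hsNorm (comp k (conjK k))) ^ n * ‖shBound k x y‖ := by
  have hR := hsNorm_nonneg (comp k (conjK k))
  have hr := rowNorm_nonneg (comp k (conjK k)) x
  have hc := colNorm_nonneg k y
  have h1 : 1 ≤ (1 + hsNorm (comp k (conjK k))) ^ n := one_le_pow₀ (by linarith)
  rw [norm_shBound]
  cases n with
  | zero => simpa [shTerm] using mul_nonneg hr hc
  | succ n =>
    calc ‖shTerm k (n + 1) x y‖
        ≤ rowNorm (comp k (conjK k)) x * colNorm (shTerm k n) y :=
          (hk.comp hk.conjK).norm_comp_le (hk.shTerm n) x y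
      _ ≤ rowNorm (comp k (conjK k)) x * (hsNorm (comp k (conjK k)) ^ n * colNorm k y) := by
          gcongr; exact colNorm_shTerm_le hk n y
      _ = hsNorm (comp k (conjK k)) ^ n * (rowNorm (comp k (conjK k)) x * colNorm k y) := by ring
      _ ≤ (1 + hsNorm (comp k (conjK k))) ^ (n + 1) *
            (‖k x y‖ + rowNorm (comp k (conjK k)) x * colNorm k y) := by
          gcongr
          · calc hsNorm (comp k (conjK k)) ^ n ≤ (1 + hsNorm (comp k (conjK k))) ^ n := by
                  gcongr; linarith
              _ ≤ _ := pow_le_pow_right₀ (by linarith) n.le_succ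
          · linarith [norm_nonneg (k x y)]

/-- The coefficients of a numerical series that dominates `sh(k)`. -/
def shMajorant (k : Ker) (n : ℕ) : ℝ :=
  ((Nat.factorial (2 * n + 1) : ℕ) : ℝ)⁻¹ * (1 + hsNorm (comp k (conjK k))) ^ n

lemma shMajorant_nonneg (k : Ker) (n : ℕ) : 0 ≤ shMajorant k n := by
  have := hsNorm_nonneg (comp k (conjK k))
  unfold shMajorant
  positivity

lemma summable_shMajorant (k : Ker) : Summable (shMajorant k) := by
  refine (Real.summable_pow_div_factorial (1 + hsNorm (comp k (conjK k)))).of_nonneg_of_le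
    (shMajorant_nonneg k) fun n => ?_
  have := hsNorm_nonneg (comp k (conjK k))
  rw [shMajorant, div_eq_mul_inv, mul_comm]
  have : (n.factorial : ℝ) ≤ ((2 * n + 1).factorial : ℝ) := by
    exact_mod_cast Nat.factorial_le (by omega)
  gcongr

lemma norm_sh_summand_le {k : Ker} (hk : IsHSKernel k) (n : ℕ) (x y : E3) :
    ‖((Nat.factorial (2 * n + 1) : ℕ) : ℂ)⁻¹ * shTerm k n x y‖
      ≤ shMajorant k n * ‖shBound k x y‖ := by
  rw [norm_mul, norm_inv, Complex.norm_natCast, shMajorant, mul_assoc]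
  gcongr
  exact norm_shTerm_le hk n x y

lemma summable_norm_sh {k : Ker} (hk : IsHSKernel k) (x y : E3) :
    Summable fun n => ‖((Nat.factorial (2 * n + 1) : ℕ) : ℂ)⁻¹ * shTerm k n x y‖ :=
  ((summable_shMajorant k).mul_right _).of_nonneg_of_le (fun _ => norm_nonneg _)
    fun n => norm_sh_summand_le hk n x y

lemma norm_sh_le {k : Ker} (hk : IsHSKernel k) (x y : E3) :
    ‖sh k x y‖ ≤ (∑' n, shMajorant k n) * ‖shBound k x y‖ := by
  refine (norm_tsum_le_tsum_norm (summable_norm_sh hk x y)).trans ?_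
  rw [← tsum_mul_right]
  exact (summable_norm_sh hk x y).tsum_le_tsum (fun n => norm_sh_summand_le hk n x y)
    ((summable_shMajorant k).mul_right _)

lemma aestronglyMeasurable_tsum {α : Type*} [MeasurableSpace α] {μ : Measure α}
    {f : ℕ → α → ℂ} (hf : ∀ n, AEStronglyMeasurable (f n) μ) (hs : ∀ x, Summable fun n => f n x) :
    AEStronglyMeasurable (fun x => ∑' n, f n x) μ :=
  aestronglyMeasurable_of_tendsto_ae Filter.atTop
    (fun n => Finset.aestronglyMeasurable_fun_sum (Finset.range n) fun i _ => hf i)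
    (.of_forall fun x => (hs x).hasSum.tendsto_sum_nat)

lemma IsHSKernel.sh {k : Ker} (hk : IsHSKernel k) : IsHSKernel (sh k) := by
  have hs := fun x y => (summable_norm_sh hk x y).of_norm
  refine of_le ((isHSKernel_shBound hk).const_mul (∑' n, shMajorant k n : ℝ)) ?_ (fun x => ?_)
    (fun y => ?_) fun x y => ?_
  · exact aestronglyMeasurable_tsum (fun n => ((hk.shTerm n).const_mul _).prod.1) fun q => hs _ _
  · exact aestronglyMeasurable_tsum (fun n => (((hk.shTerm n).const_mul _).row x).1) fun q => hs _ _
  · exact aestronglyMeasurable_tsum (fun n => (((hk.shTerm n).const_mul _).col y).1) fun q => hs _ _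
  · rw [norm_mul, Complex.norm_real, Real.norm_of_nonneg (tsum_nonneg (shMajorant_nonneg k))]
    exact norm_sh_le hk x y

/-- Both sides are the same alternating word. The recursion grows it on the left and transposition
makes it grow on the right; this reconciles the two. -/
lemma comp_shTerm_comm {k : Ker} (hk : IsHSKernel k) (n : ℕ) :
    comp (shTerm k n) (comp (conjK k) k) = comp (comp k (conjK k)) (shTerm k n) := by
  induction n with
  | zero => exact (hk.comp_assoc hk.conjK hk).symm
  | succ n ih =>
    rw [shTerm, (hk.comp hk.conjK).comp_assoc (hk.shTerm n) (hk.conjK.comp hk), ih]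

lemma transp_shTerm {k : Ker} (hk : IsPairKernel k) (n : ℕ) :
    transp (shTerm k n) = shTerm k n := by
  have h0 : transp k = k := by funext x y; exact hk.symm y x
  have h1 : transp (conjK k) = conjK k := congrArg conjK h0
  induction n with
  | zero => exact h0
  | succ n ih =>
    rw [shTerm, transp_comp, transp_comp, ih, h0, h1, comp_shTerm_comm hk.isHSKernel]

lemma sh_symm {k : Ker} (hk : IsPairKernel k) (x y : E3) : sh k x y = sh k y x := by
  refine tsum_congr fun n => ?_
  rw [← transp_shTerm hk n]
  simp only [transp, ← congrFun (congrFun (transp_shTerm hk n) x) y]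

/-- Concatenating alternating words of lengths `2m + 1` and `2n + 1`, the first starting and ending
with `k̄`, the second with `k`, gives the alternating word of length `2(m + n) + 2`. The result
depends on `m + n` only. -/
lemma comp_conjK_shTerm {k : Ker} (hk : IsHSKernel k) (m n : ℕ) :
    comp (conjK (shTerm k m)) (shTerm k n) = chTerm k (m + n) := by
  induction m with
  | zero =>
    induction n with
    | zero => rfl
    | succ n ih =>
      rw [shTerm, shTerm, ← hk.conjK.comp_assoc (hk.comp hk.conjK) (hk.shTerm n),
        ← hk.conjK.comp_assoc hk hk.conjK, (hk.conjK.comp hk).comp_assoc hk.conjK (hk.shTerm n),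
        ← add_assoc, chTerm, ← ih, shTerm]
  | succ m ih =>
    rw [shTerm, conjK_comp, conjK_comp, conjK_conjK,
      (hk.conjK.comp hk).comp_assoc (hk.shTerm m).conjK (hk.shTerm n), ih, Nat.succ_add, chTerm]

/-- `sh(k)‾ ∘ sh(k)` as a double series. -/
lemma hasSum_comp_conjK_sh {k : Ker} (hk : IsHSKernel k) (x y : E3) :
    HasSum (fun p : ℕ × ℕ => ((Nat.factorial (2 * p.1 + 1) : ℕ) : ℂ)⁻¹ *
        ((Nat.factorial (2 * p.2 + 1) : ℕ) : ℂ)⁻¹ * chTerm k (p.1 + p.2) x y)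
      (comp (conjK (sh k)) (sh k) x y) := by
  set F : ℕ × ℕ → E3 → ℂ := fun p z =>
    conj (((Nat.factorial (2 * p.1 + 1) : ℕ) : ℂ)⁻¹ * shTerm k p.1 x z) *
      (((Nat.factorial (2 * p.2 + 1) : ℕ) : ℂ)⁻¹ * shTerm k p.2 z y) with hF
  have hFint : ∀ p, Integrable (F p) := fun p =>
    ((hk.shTerm p.1).const_mul _).conjK.integrable_mul ((hk.shTerm p.2).const_mul _) x y
  have hB := ((isHSKernel_shBound hk).integrable_mul (isHSKernel_shBound hk) x y).norm
  -- Absolute convergence justifies exchanging sum and integral: the integrals are dominated by a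
  -- product of two summable majorants times one fixed integral.
  have hsum : Summable fun p => ∫ z, ‖F p z‖ := by
    refine (((summable_shMajorant k).mul_of_nonneg (summable_shMajorant k) (shMajorant_nonneg k)
      (shMajorant_nonneg k)).mul_right (∫ z, ‖shBound k x z * shBound k z y‖)).of_nonneg_of_le
        (fun p => integral_nonneg fun _ => norm_nonneg _) fun p => ?_
    rw [← integral_const_mul]
    refine integral_mono (hFint p).norm (hB.const_mul _) fun z => ?_
    calc ‖F p z‖ ≤ (shMajorant k p.1 * ‖shBound k x z‖) * (shMajorant k p.2 * ‖shBound k z y‖) := by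
          rw [hF, norm_mul, RCLike.norm_conj]
          exact mul_le_mul (norm_sh_summand_le hk _ _ _) (norm_sh_summand_le hk _ _ _)
            (norm_nonneg _) (mul_nonneg (shMajorant_nonneg _ _) (norm_nonneg _))
      _ = _ := by rw [norm_mul]; ring
  have h1 : (fun p => ∫ z, F p z) = fun p : ℕ × ℕ => ((Nat.factorial (2 * p.1 + 1) : ℕ) : ℂ)⁻¹ *
        ((Nat.factorial (2 * p.2 + 1) : ℕ) : ℂ)⁻¹ * chTerm k (p.1 + p.2) x y := by
    funext p
    rw [← comp_conjK_shTerm hk, comp, ← integral_const_mul]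
    refine integral_congr_ae (.of_forall fun z => ?_)
    simp only [hF, conjK, map_mul, map_inv₀, map_natCast]
    ring
  have h2 : ∫ z, ∑' p, F p z = comp (conjK (sh k)) (sh k) x y := by
    refine integral_congr_ae (.of_forall fun z => ?_)
    have hs := summable_norm_sh hk
    simp only [conjK, sh, hF]
    rw [Complex.conj_tsum]
    exact (tsum_mul_tsum_of_summable_norm (f := fun n => conj _)
      (by simpa only [RCLike.norm_conj] using hs x z) (hs z y)).symm
  exact h1 ▸ h2 ▸ hasSum_integral_of_summable_integral_norm hFint hsum

/-! ### The double-angle identity for kernels -/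

lemma chTerm_twice (k : Ker) (n : ℕ) (x y : E3) :
    chTerm (twice k) n x y = 2 ^ (2 * n + 2) * chTerm k n x y := by
  have h : ∀ x y, comp (conjK (twice k)) (twice k) x y = 4 * comp (conjK k) k x y := fun x y => by
    simp only [comp, ← integral_const_mul]
    congr 1 with z
    simp only [conjK, twice, map_mul, Complex.conj_ofNat]
    ring
  induction n generalizing x y with
  | zero => rw [chTerm, h, chTerm]; norm_num
  | succ n ih =>
    rw [chTerm, chTerm, comp, comp, ← integral_const_mul]
    congr 1 with z
    rw [h, ih]
    ring

lemma sum_range_two_mul {M : Type*} [AddCommMonoid M] (f : ℕ → M) (n : ℕ) :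
    ∑ i ∈ Finset.range (2 * n), f i = ∑ m ∈ Finset.range n, (f (2 * m) + f (2 * m + 1)) := by
  induction n with
  | zero => simp
  | succ n ih => rw [Nat.mul_succ, Finset.sum_range_succ, Finset.sum_range_succ, ih,
      Finset.sum_range_succ, add_assoc]

/-- Pascal's rule splits each odd-index coefficient into two neighbours of row `2j + 1`; together
these exhaust that row. -/
lemma sum_choose_odd (j : ℕ) :
    ∑ m ∈ Finset.range (j + 1), (2 * j + 2).choose (2 * m + 1) = 2 ^ (2 * j + 1) := by
  simp_rw [Nat.choose_succ_succ' (2 * j + 1)]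
  rw [← sum_range_two_mul, ← Nat.sum_range_choose]
  rfl

/-- This compares the coefficients of `x^(2j+2)` in `sinh² x` and in `(cosh 2x - 1)/2`. -/
lemma sum_antidiagonal_inv_factorial (j : ℕ) :
    ∑ p ∈ Finset.HasAntidiagonal.antidiagonal j, ((Nat.factorial (2 * p.1 + 1) : ℕ) : ℂ)⁻¹ *
        ((Nat.factorial (2 * p.2 + 1) : ℕ) : ℂ)⁻¹
      = 2 ^ (2 * j + 1) * ((Nat.factorial (2 * j + 2) : ℕ) : ℂ)⁻¹ := by
  rw [Finset.Nat.sum_antidiagonal_eq_sum_range_succ_mk]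
  have h := congrArg (Nat.cast : ℕ → ℂ) (sum_choose_odd j)
  push_cast at h
  rw [← h, Finset.sum_mul]
  refine Finset.sum_congr rfl fun m hm => ?_
  have hm' : m ≤ j := Nat.lt_succ_iff.1 (Finset.mem_range.1 hm)
  have h1 : 2 * j + 2 - (2 * m + 1) = 2 * (j - m) + 1 := by omega
  rw [Nat.cast_choose ℂ (by omega : 2 * m + 1 ≤ 2 * j + 2), h1]
  have h2 := Nat.factorial_ne_zero (2 * j + 2)
  have h3 := Nat.factorial_ne_zero (2 * m + 1)
  have h4 := Nat.factorial_ne_zero (2 * (j - m) + 1)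
  field_simp

/-- The kernel form of `cosh(2x) - 1 = 2 sinh²(x)`. -/
lemma chReg_twice {k : Ker} (hk : IsHSKernel k) (x y : E3) :
    chReg (twice k) x y = 2 * comp (conjK (sh k)) (sh k) x y := by
  have h := hasSum_comp_conjK_sh hk x y
  -- The double series is summed along antidiagonals, on each of which the kernel factor is
  -- constant.
  have h' := ((Finset.HasAntidiagonal.sigmaAntidiagonalEquivProd.hasSum_iff).2 h).sigma
    fun n => hasSum_fintype _
  rw [← h'.tsum_eq, ← tsum_mul_left, chReg]
  refine tsum_congr fun j => ?_
  have h1 : ∑ p ∈ Finset.HasAntidiagonal.antidiagonal j, ((Nat.factorial (2 * p.1 + 1) : ℕ) : ℂ)⁻¹ *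
        ((Nat.factorial (2 * p.2 + 1) : ℕ) : ℂ)⁻¹ * chTerm k (p.1 + p.2) x y
      = 2 ^ (2 * j + 1) * ((Nat.factorial (2 * j + 2) : ℕ) : ℂ)⁻¹ * chTerm k j x y := by
    rw [← sum_antidiagonal_inv_factorial, Finset.sum_mul]
    refine Finset.sum_congr rfl fun p hp => ?_
    rw [Finset.HasAntidiagonal.mem_antidiagonal.1 hp]
  rw [← Finset.sum_coe_sort] at h1
  rw [chTerm_twice]
  simp only [Function.comp_apply, Finset.HasAntidiagonal.sigmaAntidiagonalEquivProd_apply]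
  rw [h1]
  ring

lemma IsHSKernel.chReg_twice {k : Ker} (hk : IsHSKernel k) : IsHSKernel (chReg (twice k)) := by
  have h : chReg (PairExcitation.twice k)
      = fun x y => 2 * PairExcitation.comp (PairExcitation.conjK (PairExcitation.sh k))
        (PairExcitation.sh k) x y := by
    funext x y; exact PairExcitation.chReg_twice hk x y
  rw [h]
  exact (hk.sh.conjK.comp hk.sh).const_mul 2

/-- By symmetry of `sh k`, the kernel `conjK (sh k)` is its adjoint, so `p` has the Hermitian form
`2 A* A`. -/
lemma conj_chReg_twice {k : Ker} (hk : IsPairKernel k) (x y : E3) :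
    conj (chReg (twice k) x y) = chReg (twice k) y x := by
  simp only [chReg_twice hk.isHSKernel, comp, map_mul, ← integral_conj, conjK, Complex.conj_conj,
    Complex.conj_ofNat]
  congr 2 with z
  rw [sh_symm hk x z, sh_symm hk z y]
  ring

/-! ### The interaction terms -/

/-- An even bounded continuous potential `w`, a condensate `φ`, a symmetric kernel `u` and a
Hermitian kernel `p`, together with `Λ = c u + φ ⊗ φ` and `Γ = c p + φ̄ ⊗ φ`. -/
structure IsMeanField (w : E3 → ℝ) (c : ℂ) (φ : E3 → ℂ) (u p Λ Γ : Ker) : Prop where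
  continuous_pot : Continuous w
  bounded_pot : ∃ M, ∀ x, |w x| ≤ M
  even_pot : ∀ x, w (-x) = w x
  conj_const : conj c = c
  memLp : MemLp φ 2 volume
  hs_u : IsHSKernel u
  hs_p : IsHSKernel p
  symm : ∀ x y, u x y = u y x
  herm : ∀ x y, conj (p x y) = p y x
  diag : Integrable fun y => p y y
  Lam_eq : ∀ x y, Λ x y = c * u x y + φ x * φ y
  Gam_eq : ∀ x y, Γ x y = c * p x y + conj (φ x) * φ y

/-- `∫ w(x - z) (c p(z, x) φ(z) + c u(x, z) φ̄(z)) dz`, the action of the pair excitations on the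
condensate. -/
def pairForce (w : E3 → ℝ) (c : ℂ) (φ : E3 → ℂ) (u p : Ker) (x : E3) : ℂ :=
  ∫ z, (w (x - z) : ℂ) * (c * p z x * φ z + c * u x z * conj (φ z))

/-- The interaction terms of the equation for the condensate. -/
def condensateForce (w : E3 → ℝ) (c : ℂ) (φ : E3 → ℂ) (u p Γ : Ker) (x : E3) : ℂ :=
  convTr w Γ x * φ x + pairForce w c φ u p x

/-- `∫ w(x - z) |φ(z)|² dz`. -/
def convDensity (w : E3 → ℝ) (φ : E3 → ℂ) (x : E3) : ℂ :=
  ∫ z, (w (x - z) : ℂ) * ((‖φ z‖ ^ 2 : ℝ) : ℂ)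

lemma ofReal_norm_sq (a : ℂ) : ((‖a‖ ^ 2 : ℝ) : ℂ) = conj a * a := by
  rw [Complex.conj_mul', Complex.ofReal_pow]

/-- The common shape of the four expansions below: two compositions, one pair force and one density
term. -/
lemma integral_lin_comb {F₁ F₂ F₃ H G : E3 → ℂ} (h₁ : Integrable F₁) (h₂ : Integrable F₂)
    (h₃ : Integrable F₃) (hH : Integrable H) (c d e : ℂ)
    (h : ∀ z, G z = c * (F₁ z + F₂ z) + d * F₃ z + e * H z) :
    ∫ z, G z = c * ((∫ z, F₁ z) + ∫ z, F₂ z) + d * (∫ z, F₃ z) + e * ∫ z, H z := by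
  simp_rw [h]
  have h12 : Integrable fun z => c * (F₁ z + F₂ z) := (h₁.add h₂).const_mul c
  have h3 : Integrable fun z => d * F₃ z := h₃.const_mul d
  have h4 : Integrable fun z => e * H z := hH.const_mul e
  have h5 : Integrable fun z => c * (F₁ z + F₂ z) + d * F₃ z := h12.add h3
  rw [integral_add h5 h4, integral_add h12 h3, integral_const_mul,
    integral_const_mul, integral_const_mul, integral_add h₁ h₂]

namespace IsMeanField

variable {w : E3 → ℝ} {c : ℂ} {φ : E3 → ℂ} {u p Λ Γ : Ker}

lemma pot_mul (h : IsMeanField w c φ u p Λ Γ) {f : E3 → ℂ} (hf : Integrable f) (x : E3) :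
    Integrable fun z => (w (x - z) : ℂ) * f z := by
  obtain ⟨M, hM⟩ := h.bounded_pot
  refine hf.bdd_mul (c := M) ?_ (.of_forall fun z => ?_)
  · have := h.continuous_pot
    exact Continuous.aestronglyMeasurable (by fun_prop)
  · simpa using hM (x - z)

lemma pot_comm (h : IsMeanField w c φ u p Λ Γ) (x y : E3) : w (x - y) = w (y - x) := by
  rw [← h.even_pot, neg_sub]

lemma hs_Lam (h : IsMeanField w c φ u p Λ Γ) : IsHSKernel Λ := by
  have : Λ = fun x y => c * u x y + φ x * φ y := by funext x y; exact h.Lam_eq x y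
  rw [this]
  exact (h.hs_u.const_mul c).add (.mul h.memLp h.memLp)

lemma hs_Gam (h : IsMeanField w c φ u p Λ Γ) : IsHSKernel Γ := by
  have : Γ = fun x y => c * p x y + conj (φ x) * φ y := by funext x y; exact h.Gam_eq x y
  rw [this]
  exact (h.hs_p.const_mul c).add (.mul h.memLp.star h.memLp)

lemma conj_Gam (h : IsMeanField w c φ u p Λ Γ) (x y : E3) : conj (Γ x y) = Γ y x := by
  simp only [h.Gam_eq, map_add, map_mul, h.conj_const, h.herm, Complex.conj_conj]
  ring

lemma integrable_density (h : IsMeanField w c φ u p Λ Γ) :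
    Integrable fun z => ((‖φ z‖ ^ 2 : ℝ) : ℂ) :=
  ((memLp_two_iff_integrable_sq_norm h.memLp.1).1 h.memLp).ofReal

lemma integrable_diag_Gam (h : IsMeanField w c φ u p Λ Γ) : Integrable fun z => Γ z z := by
  simp_rw [h.Gam_eq, ← ofReal_norm_sq]
  exact (h.diag.const_mul c).add h.integrable_density

lemma conj_convTr (h : IsMeanField w c φ u p Λ Γ) (x : E3) :
    conj (convTr w Γ x) = convTr w Γ x := by
  simp only [convTr, ← integral_conj, map_mul, Complex.conj_ofReal, h.conj_Gam]

lemma integrable_pairForce (h : IsMeanField w c φ u p Λ Γ) (x : E3) :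
    Integrable fun z => (w (x - z) : ℂ) * (c * p z x * φ z + c * u x z * conj (φ z)) :=
  h.pot_mul (((h.hs_p.const_mul c).col x |>.integrable_mul h.memLp).add
    ((h.hs_u.const_mul c).row x |>.integrable_mul h.memLp.star)) x

/-- The weight `w(x - z)` is absorbed by the left factor of each product, and the right factor is
split into its `c`-part and its condensate part. The `c`-parts give the compositions. The condensate
parts produce the pair force and one density term per product, hence the coefficient `2`. -/
lemma Lam_part_left (h : IsMeanField w c φ u p Λ Γ) (x y : E3) :
    ∫ z, (w (x - z) : ℂ) * (Λ x z * Γ z y + conj (Γ x z) * Λ z y)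
      = c * (comp (transp (potMul w Γ)) u x y + comp (potMul w Λ) p x y)
        + φ y * pairForce w c φ u p x + 2 * φ x * φ y * convDensity w φ x := by
  have h1 : Integrable fun z => transp (potMul w Γ) x z * u z y := by
    refine (h.pot_mul (h.hs_Gam.transp.integrable_mul h.hs_u x y) x).congr (.of_forall fun z => ?_)
    simp only [transp, potMul, h.pot_comm z x]
    ring
  have h2 : Integrable fun z => potMul w Λ x z * p z y := by
    refine (h.pot_mul (h.hs_Lam.integrable_mul h.hs_p x y) x).congr (.of_forall fun z => ?_)
    simp only [potMul]
    ring
  refine integral_lin_comb h1 h2 (h.integrable_pairForce x) (h.pot_mul h.integrable_density x)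
    _ _ _ fun z => ?_
  simp only [transp, potMul, h.pot_comm z x, h.Lam_eq, h.Gam_eq, ofReal_norm_sq,
    h.herm, map_add, map_mul, h.conj_const, Complex.conj_conj]
  ring

lemma Lam_part_right (h : IsMeanField w c φ u p Λ Γ) (x y : E3) :
    ∫ z, (w (y - z) : ℂ) * (Λ x z * Γ z y + conj (Γ x z) * Λ z y)
      = c * (comp u (potMul w Γ) x y + comp (conjK p) (potMul w Λ) x y)
        + φ x * pairForce w c φ u p y + 2 * φ x * φ y * convDensity w φ y := by
  have h1 : Integrable fun z => u x z * potMul w Γ z y := by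
    refine (h.pot_mul (h.hs_u.integrable_mul h.hs_Gam x y) y).congr (.of_forall fun z => ?_)
    simp only [potMul, h.pot_comm z y]
    ring
  have h2 : Integrable fun z => conjK p x z * potMul w Λ z y := by
    refine (h.pot_mul (h.hs_p.conjK.integrable_mul h.hs_Lam x y) y).congr (.of_forall fun z => ?_)
    simp only [potMul, h.pot_comm z y]
    ring
  refine integral_lin_comb h1 h2 (h.integrable_pairForce y) (h.pot_mul h.integrable_density y)
    _ _ _ fun z => ?_
  simp only [conjK, potMul, h.pot_comm z y, h.Lam_eq, h.Gam_eq, ofReal_norm_sq,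
    h.herm, map_add, map_mul, h.conj_const, Complex.conj_conj, h.symm y z]
  ring

lemma Gam_part_left (h : IsMeanField w c φ u p Λ Γ) (x y : E3) :
    ∫ z, (w (x - z) : ℂ) * (Λ x z * conj (Λ z y) + conj (Γ x z) * conj (Γ z y))
      = c * (comp (transp (potMul w Γ)) (conjK p) x y + comp (potMul w Λ) (conjK u) x y)
        + conj (φ y) * pairForce w c φ u p x + 2 * φ x * conj (φ y) * convDensity w φ x := by
  have h1 : Integrable fun z => transp (potMul w Γ) x z * conjK p z y := by
    refine (h.pot_mul (h.hs_Gam.transp.integrable_mul h.hs_p.conjK x y) x).congr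
      (.of_forall fun z => ?_)
    simp only [transp, potMul, h.pot_comm z x]
    ring
  have h2 : Integrable fun z => potMul w Λ x z * conjK u z y := by
    refine (h.pot_mul (h.hs_Lam.integrable_mul h.hs_u.conjK x y) x).congr (.of_forall fun z => ?_)
    simp only [potMul]
    ring
  refine integral_lin_comb h1 h2 (h.integrable_pairForce x) (h.pot_mul h.integrable_density x)
    _ _ _ fun z => ?_
  simp only [transp, conjK, potMul, h.pot_comm z x, h.Lam_eq, h.Gam_eq, ofReal_norm_sq,
    h.herm, map_add, map_mul, h.conj_const, Complex.conj_conj]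
  ring

/-- Now the left factors are split. The second variable of `Γ̄` carries `φ̄`, so the force at `y`
appears conjugated. -/
lemma Gam_part_right (h : IsMeanField w c φ u p Λ Γ) (x y : E3) :
    ∫ z, (w (y - z) : ℂ) * (Λ x z * conj (Λ z y) + conj (Γ x z) * conj (Γ z y))
      = c * (comp (conjK p) (transp (potMul w Γ)) x y + comp u (conjK (potMul w Λ)) x y)
        + φ x * conj (pairForce w c φ u p y) + 2 * φ x * conj (φ y) * convDensity w φ y := by
  have h1 : Integrable fun z => conjK p x z * transp (potMul w Γ) z y := by
    refine (h.pot_mul (h.hs_p.conjK.integrable_mul h.hs_Gam.transp x y) y).congr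
      (.of_forall fun z => ?_)
    simp only [transp, potMul]
    ring
  have h2 : Integrable fun z => u x z * conjK (potMul w Λ) z y := by
    refine (h.pot_mul (h.hs_u.integrable_mul h.hs_Lam.conjK x y) y).congr (.of_forall fun z => ?_)
    simp only [potMul, conjK, map_mul, Complex.conj_ofReal, h.pot_comm z y]
    ring
  rw [pairForce, ← integral_conj]
  refine integral_lin_comb h1 h2
    ((LinearIsometryEquiv.integrable_comp_iff Complex.conjLIE).2 (h.integrable_pairForce y))
    (h.pot_mul h.integrable_density y) _ _ _ fun z => ?_
  simp only [transp, conjK, potMul, h.pot_comm z y, h.Lam_eq, h.Gam_eq, ofReal_norm_sq,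
    h.herm, map_add, map_mul, h.conj_const, Complex.conj_conj,
    Complex.conj_ofReal, Complex.conjLIE_apply, h.symm y z]
  ring

/-- The interaction terms of the equation for `Λ`. -/
lemma Lam_interaction (h : IsMeanField w c φ u p Λ Γ) (x y : E3) :
    -(∫ z, ((w (x - z) : ℂ) * Γ z z + (w (y - z) : ℂ) * Γ z z)) * Λ x y
        - (∫ z, ((w (x - z) : ℂ) + (w (y - z) : ℂ)) * (Λ x z * Γ z y + conj (Γ x z) * Λ z y))
        + 2 * (∫ z, ((w (x - z) : ℂ) + (w (y - z) : ℂ)) *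
            ((‖φ z‖ ^ 2 : ℝ) : ℂ) * φ x * φ y)
      = -(c * ((convTr w Γ x * u x y + comp (transp (potMul w Γ)) u x y)
            + (u x y * convTr w Γ y + comp u (potMul w Γ) x y)
            + comp (potMul w Λ) p x y + comp (conjK p) (potMul w Λ) x y)
          + φ y * condensateForce w c φ u p Γ x + φ x * condensateForce w c φ u p Γ y) := by
  have hI : Integrable fun z => Λ x z * Γ z y + conj (Γ x z) * Λ z y :=
    (h.hs_Lam.integrable_mul h.hs_Gam x y).add (h.hs_Gam.conjK.integrable_mul h.hs_Lam x y)
  have e1 : ∫ z, ((w (x - z) : ℂ) * Γ z z + (w (y - z) : ℂ) * Γ z z)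
      = convTr w Γ x + convTr w Γ y :=
    integral_add (h.pot_mul h.integrable_diag_Gam x) (h.pot_mul h.integrable_diag_Gam y)
  have e2 := integral_add (h.pot_mul hI x) (h.pot_mul hI y)
  have e3 := integral_add (h.pot_mul h.integrable_density x) (h.pot_mul h.integrable_density y)
  simp_rw [← add_mul] at e2 e3
  rw [h.Lam_part_left, h.Lam_part_right] at e2
  change _ = convDensity w φ x + convDensity w φ y at e3
  -- The density terms cancel, and the `φ ⊗ φ` part of `Λ` supplies the `convTr` half of each
  -- condensate force.
  rw [integral_mul_const, integral_mul_const, e1, e2, e3, h.Lam_eq x y, condensateForce,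
    condensateForce]
  ring

/-- The interaction terms of the equation for `Γ̄`. -/
lemma Gam_interaction (h : IsMeanField w c φ u p Λ Γ) (x y : E3) :
    -(∫ z, ((w (x - z) : ℂ) - (w (y - z) : ℂ)) * (Λ x z * conj (Λ z y)))
        - (∫ z, ((w (x - z) : ℂ) - (w (y - z) : ℂ)) *
            (conj (Γ x z) * conj (Γ z y) + conj (Γ z z) * conj (Γ x y)))
        + 2 * (∫ z, ((w (x - z) : ℂ) - (w (y - z) : ℂ)) *
            ((‖φ z‖ ^ 2 : ℝ) : ℂ) * φ x * conj (φ y))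
      = -(c * ((convTr w Γ x * conjK p x y + comp (transp (potMul w Γ)) (conjK p) x y)
            - (conjK p x y * convTr w Γ y + comp (conjK p) (transp (potMul w Γ)) x y)
            + comp (potMul w Λ) (conjK u) x y - comp u (conjK (potMul w Λ)) x y)
          + conj (φ y) * condensateForce w c φ u p Γ x
          - φ x * conj (condensateForce w c φ u p Γ y)) := by
  have hL : Integrable fun z => Λ x z * conj (Λ z y) := h.hs_Lam.integrable_mul h.hs_Lam.conjK x y
  have hG : Integrable fun z => conj (Γ x z) * conj (Γ z y) :=
    h.hs_Gam.conjK.integrable_mul h.hs_Gam.conjK x y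
  have hI : Integrable fun z => Λ x z * conj (Λ z y) + conj (Γ x z) * conj (Γ z y) := hL.add hG
  have e1 : (∫ z, ((w (x - z) : ℂ) - (w (y - z) : ℂ)) * Γ z z) = convTr w Γ x - convTr w Γ y := by
    simp_rw [sub_mul]
    exact integral_sub (h.pot_mul h.integrable_diag_Gam x) (h.pot_mul h.integrable_diag_Gam y)
  have e2 := integral_sub (h.pot_mul hI x) (h.pot_mul hI y)
  have e3 := integral_sub (h.pot_mul h.integrable_density x) (h.pot_mul h.integrable_density y)
  have hsub : ∀ {f : E3 → ℂ}, Integrable f →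
      Integrable fun z => ((w (x - z) : ℂ) - (w (y - z) : ℂ)) * f z := fun hf => by
    simp_rw [sub_mul]
    exact (h.pot_mul hf x).sub (h.pot_mul hf y)
  have hT := (hsub h.integrable_diag_Gam).mul_const (conj (Γ x y))
  -- The direct term is split off so that the exchange term can be joined with `Λ Λ̄`, the
  -- combination that expands well.
  have e4 : (∫ z, ((w (x - z) : ℂ) - (w (y - z) : ℂ)) *
      (conj (Γ x z) * conj (Γ z y) + conj (Γ z z) * conj (Γ x y)))
      = (∫ z, ((w (x - z) : ℂ) - (w (y - z) : ℂ)) * (conj (Γ x z) * conj (Γ z y)))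
        + (convTr w Γ x - convTr w Γ y) * conj (Γ x y) := by
    rw [← e1, ← integral_mul_const, ← integral_add (hsub hG) hT]
    congr 1 with z
    rw [h.conj_Gam z z]
    ring
  have e5 := integral_add (hsub hL) (hsub hG)
  simp_rw [← mul_add] at e5
  simp_rw [← sub_mul] at e2 e3
  rw [h.Gam_part_left, h.Gam_part_right] at e2
  rw [e2] at e5
  change _ = convDensity w φ x - convDensity w φ y at e3
  have hΓ : conj (Γ x y) = c * conjK p x y + φ x * conj (φ y) := by
    simp [h.Gam_eq, h.conj_const, conjK]
  rw [integral_mul_const, integral_mul_const, e3, e4, hΓ, condensateForce, condensateForce,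
    map_add, map_mul, h.conj_convTr]
  linear_combination e5

end IsMeanField

/-! ### The scaled interaction and the mean-field data of a pair excitation kernel -/

lemma continuous_vN (v : 𝓢(E3, ℝ)) (β : ℝ) (N : ℕ) : Continuous (vN v β N) :=
  continuous_const.mul (v.continuous.comp (continuous_const_smul _))

lemma vN_bounded (v : 𝓢(E3, ℝ)) (β : ℝ) (N : ℕ) : ∃ M, ∀ x, |vN v β N x| ≤ M := by
  refine ⟨|(N : ℝ) ^ (3 * β)| * ‖v.toBoundedContinuousFunction‖, fun x => ?_⟩
  rw [vN, abs_mul]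
  exact mul_le_mul_of_nonneg_left (v.toBoundedContinuousFunction.norm_coe_le_norm _) (abs_nonneg _)

lemma vN_even {v : 𝓢(E3, ℝ)} (hv : ∀ x, v (-x) = v x) (β : ℝ) (N : ℕ) (x : E3) :
    vN v β N (-x) = vN v β N x := by
  simp only [vN, smul_neg, hv]

lemma Gam_eq_chReg {k : Ker} (hk : IsPairKernel k) (N : ℕ) (φ : E3 → ℂ) (x y : E3) :
    Gam N φ k x y = 1 / (2 * (N : ℂ)) * chReg (twice k) x y + conj (φ x) * φ y := by
  rw [chReg_twice hk.isHSKernel, Gam, one_div, one_div, mul_inv]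
  ring

/-- The condensate equation contains the conjugate of `sh(k)‾ ∘ sh(k)`, which by Hermitian symmetry
is its transpose. -/
lemma comp_sh_conjK_sh {k : Ker} (hk : IsPairKernel k) (N : ℕ) (x y : E3) :
    1 / (N : ℂ) * comp (sh k) (conjK (sh k)) x y
      = 1 / (2 * (N : ℂ)) * chReg (twice k) y x := by
  have h : comp (sh k) (conjK (sh k)) x y = conj (comp (conjK (sh k)) (sh k) x y) := by
    change _ = conjK (comp (conjK (sh k)) (sh k)) x y
    rw [conjK_comp, conjK_conjK]
  have h2 := chReg_twice hk.isHSKernel x y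
  rw [← conj_chReg_twice hk, h, h2, map_mul, Complex.conj_ofNat, one_div, one_div, mul_inv]
  ring

lemma isMeanField {v : 𝓢(E3, ℝ)} (hv : ∀ x, v (-x) = v x) (β : ℝ) (N : ℕ) {φ : E3 → ℂ}
    (hφ : MemLp φ 2 volume) {k : Ker} (hk : IsPairKernel k) :
    IsMeanField (vN v β N) (1 / (2 * (N : ℂ))) φ (sh (twice k)) (chReg (twice k))
      (Lam N φ k) (Gam N φ k) where
  continuous_pot := continuous_vN v β N
  bounded_pot := vN_bounded v β N
  even_pot := vN_even hv β N
  conj_const := by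
    simp only [map_div₀, map_mul, map_one, map_natCast, Complex.conj_ofNat]
  memLp := hφ
  hs_u := hk.twice.isHSKernel.sh
  hs_p := hk.isHSKernel.chReg_twice
  symm := sh_symm hk.twice
  herm := conj_chReg_twice hk
  -- Square integrability says nothing about the diagonal; integrability there comes from `p` being
  -- a composition of two Hilbert–Schmidt kernels.
  diag := by
    simp_rw [chReg_twice hk.isHSKernel]
    exact (hk.isHSKernel.sh.conjK.integrable_diag_comp hk.isHSKernel.sh).const_mul 2
  Lam_eq _ _ := rfl
  Gam_eq := Gam_eq_chReg hk N φ

/-! ### The common force in the two equations for the condensate -/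

namespace IsMeanField

variable {w : E3 → ℝ} {c : ℂ} {φ : E3 → ℂ} {u p Λ Γ : Ker}

/-- The right-hand side of the equation for `φ` in the closed system. -/
lemma phi_interaction (h : IsMeanField w c φ u p Λ Γ) (x : E3) :
    -(∫ y, (w (x - y) : ℂ) * Γ y y) * φ x
        - (∫ y, ((w (x - y) : ℂ) * φ y * (Γ y x - conj (φ y) * φ x)
            + (w (x - y) : ℂ) * conj (φ y) * (Λ x y - φ x * φ y)))
      = -condensateForce w c φ u p Γ x := by
  rw [condensateForce, convTr, pairForce, neg_add, neg_mul, sub_eq_add_neg]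
  congr 3 with y
  rw [h.Gam_eq y x, h.Lam_eq]
  ring

/-- The interaction terms of the equation for `φ` in the coupled system. -/
lemma condensate_interaction (h : IsMeanField w c φ u p Λ Γ) {a : ℂ} {q : Ker}
    (hq : ∀ x y, a * q x y = c * p y x) (x : E3) :
    (∫ y, (w (x - y) : ℂ) * Λ x y * conj (φ y)) + a * convTr w q x * φ x
        + a * (∫ y, (w (x - y) : ℂ) * q x y * φ y)
      = condensateForce w c φ u p Γ x := by
  have e1 : a * convTr w q x = ∫ y, (w (x - y) : ℂ) * (c * p y y) := by
    rw [convTr, ← integral_const_mul]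
    congr 1 with y
    rw [← hq]
    ring
  have e2 : a * (∫ y, (w (x - y) : ℂ) * q x y * φ y)
      = ∫ y, (w (x - y) : ℂ) * (c * p y x * φ y) := by
    rw [← integral_const_mul]
    congr 1 with y
    rw [← hq]
    ring
  have iu : Integrable fun y => (w (x - y) : ℂ) * (c * u x y * conj (φ y)) :=
    h.pot_mul (((h.hs_u.const_mul c).row x).integrable_mul h.memLp.star) x
  have ip : Integrable fun y => (w (x - y) : ℂ) * (c * p y x * φ y) :=
    h.pot_mul (((h.hs_p.const_mul c).col x).integrable_mul h.memLp) x
  have id := h.pot_mul h.integrable_density x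
  -- The condensate part of `Λ` yields `(w * |φ|²) φ`, exactly what the trace of `c p` lacks to
  -- become that of `Γ`.
  have e3 : ∫ y, (w (x - y) : ℂ) * Λ x y * conj (φ y)
      = (∫ y, (w (x - y) : ℂ) * (c * u x y * conj (φ y))) + convDensity w φ x * φ x := by
    rw [convDensity, ← integral_mul_const, ← integral_add iu (id.mul_const _)]
    congr 1 with y
    rw [h.Lam_eq, ofReal_norm_sq]
    ring
  have e4 : convTr w Γ x = (∫ y, (w (x - y) : ℂ) * (c * p y y)) + convDensity w φ x := by
    rw [convTr, convDensity, ← integral_add (h.pot_mul (h.diag.const_mul c) x) id]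
    congr 1 with y
    rw [h.Gam_eq, ofReal_norm_sq]
    ring
  have e5 : pairForce w c φ u p x = (∫ y, (w (x - y) : ℂ) * (c * p y x * φ y))
      + ∫ y, (w (x - y) : ℂ) * (c * u x y * conj (φ y)) := by
    rw [pairForce, ← integral_add ip iu]
    congr 1 with y
    ring
  rw [condensateForce, e1, e2, e3, e4, e5]
  ring

end IsMeanField

/-! ### Time derivatives and Laplacians of sums and products -/

section Calculus

variable {I : Set ℝ} {A B D : ℝ → Ker} {φ ψ : ℝ → E3 → ℂ} {a d : ℂ} {t : ℝ}

lemma RegularField.conj (hφ : RegularField I φ) : RegularField I fun t x => conj (φ t x) :=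
  ⟨fun t ht x => (hφ.1 t ht x).star, fun t ht => Complex.conjCLE.contDiff.comp (hφ.2 t ht)⟩

lemma RegularField.mul (hφ : RegularField I φ) (hψ : RegularField I ψ) :
    RegularKer I fun t x y => φ t x * ψ t y :=
  ⟨fun t ht x y => (hφ.1 t ht x).mul (hψ.1 t ht y),
    fun t ht => ((hφ.2 t ht).comp contDiff_fst).mul ((hψ.2 t ht).comp contDiff_snd)⟩

lemma RegularKer.lin_comb (hA : RegularKer I A) (hD : RegularKer I D)
    (hB : ∀ t ∈ I, ∀ x y, B t x y = a * A t x y + d * D t x y) : RegularKer I B := by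
  refine ⟨fun t ht x y => ?_, fun t ht => ?_⟩
  · exact (((hA.1 t ht x y).const_mul a).add ((hD.1 t ht x y).const_mul d)).congr
      (fun s hs => hB s hs x y) (hB t ht x y)
  · simp_rw [hB t ht]
    exact (contDiff_const.mul (hA.2 t ht)).add (contDiff_const.mul (hD.2 t ht))

/-- The relation can be solved for `A`, so regularity passes both ways between `u` and `Λ`, and
between `p̄` and `Γ̄`. -/
lemma regularKer_iff (ha : a ≠ 0) (hD : RegularKer I D)
    (hB : ∀ t ∈ I, ∀ x y, B t x y = a * A t x y + D t x y) :
    RegularKer I B ↔ RegularKer I A := by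
  refine ⟨fun h => h.lin_comb (a := a⁻¹) (d := -a⁻¹) hD fun t ht x y => ?_,
    fun h => h.lin_comb (a := a) (d := 1) hD fun t ht x y => by rw [hB t ht, one_mul]⟩
  rw [hB t ht]
  field_simp
  ring

lemma Dt_mul {f g : ℝ → ℂ} (hf : DifferentiableWithinAt ℝ f I t)
    (hg : DifferentiableWithinAt ℝ g I t) :
    Dt I (fun τ => f τ * g τ) t = Dt I f t * g t + f t * Dt I g t := by
  have := derivWithin_mul hf hg
  simp only [Dt]
  erw [this]
  ring

/-- The sign is that of the conjugate of `1/i`; it is why differences replace sums in the equation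
for `Γ̄`. -/
lemma Dt_conj (f : ℝ → ℂ) : Dt I (fun τ => conj (f τ)) t = -conj (Dt I f t) := by
  have : derivWithin (fun τ => conj (f τ)) I t = conj (derivWithin f I t) := derivWithin.star
  simp [Dt, this]

lemma RegularKer.Dt_add (hA : RegularKer I A) (hD : RegularKer I D) (ht : t ∈ I)
    (hB : ∀ t ∈ I, ∀ x y, B t x y = a * A t x y + D t x y) (x y : E3) :
    Dt I (fun τ => B τ x y) t = a * Dt I (fun τ => A τ x y) t + Dt I (fun τ => D τ x y) t := by
  have h1 : derivWithin (fun τ => B τ x y) I t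
      = derivWithin (fun τ => a * A τ x y + D τ x y) I t :=
    derivWithin_congr (fun s hs => hB s hs x y) (hB t ht x y)
  rw [Dt, h1, derivWithin_fun_add ((hA.1 t ht x y).const_mul a) (hD.1 t ht x y),
    derivWithin_const_mul a (hA.1 t ht x y), Dt, Dt]
  ring

lemma laplacian_const_mul {f : E3 → ℂ} (hf : ContDiff ℝ 2 f) (a : ℂ) (x : E3) :
    Laplacian.laplacian (fun z => a * f z) x = a * Laplacian.laplacian f x :=
  ContDiffAt.laplacian_CLM_comp_left (l := ContinuousLinearMap.mul ℝ ℂ a) hf.contDiffAt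

lemma laplacian_lin_comb {f g : E3 → ℂ} (hf : ContDiff ℝ 2 f) (hg : ContDiff ℝ 2 g) (a b : ℂ)
    (x : E3) : Laplacian.laplacian (fun z => a * f z + b * g z) x
      = a * Laplacian.laplacian f x + b * Laplacian.laplacian g x := by
  rw [← laplacian_const_mul hf, ← laplacian_const_mul hg]
  exact ContDiffAt.laplacian_add (contDiff_const.mul hf).contDiffAt
    (contDiff_const.mul hg).contDiffAt

lemma laplacian_conj (f : E3 → ℂ) (x : E3) :
    Laplacian.laplacian (fun z => conj (f z)) x = conj (Laplacian.laplacian f x) :=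
  congrFun (InnerProductSpace.laplacian_CLE_comp_left (l := Complex.conjCLE) (f := f)) x

lemma lap₁_lin_comb {A B : Ker} {f g : E3 → ℂ} (hA : ContDiff ℝ 2 fun q : E3 × E3 => A q.1 q.2)
    (hf : ContDiff ℝ 2 f) (hB : ∀ x y, B x y = a * A x y + f x * g y) (x y : E3) :
    lap₁ B x y = a * lap₁ A x y + Laplacian.laplacian f x * g y := by
  have h : (fun z => B z y) = fun z => a * A z y + g y * f z := by
    funext z; rw [hB, mul_comm (f z)]
  have hA' : ContDiff ℝ 2 fun z => A z y := hA.comp (contDiff_id.prodMk contDiff_const)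
  rw [lap₁, h, laplacian_lin_comb hA' hf, lap₁, mul_comm (g y)]

lemma lap₂_lin_comb {A B : Ker} {f g : E3 → ℂ} (hA : ContDiff ℝ 2 fun q : E3 × E3 => A q.1 q.2)
    (hg : ContDiff ℝ 2 g) (hB : ∀ x y, B x y = a * A x y + f x * g y) (x y : E3) :
    lap₂ B x y = a * lap₂ A x y + f x * Laplacian.laplacian g y := by
  have h : (fun z => B x z) = fun z => a * A x z + f x * g z := by
    funext z; rw [hB]
  have hA' : ContDiff ℝ 2 fun z => A x z := hA.comp (contDiff_const.prodMk contDiff_id)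
  rw [lap₂, h, laplacian_lin_comb hA' hg, lap₂]

end Calculus

/-! ### Equivalence of the equations -/

section Equivalence

variable {v : 𝓢(E3, ℝ)} {β : ℝ} {N : ℕ} {I : Set ℝ} {φ : ℝ → E3 → ℂ} {k : ℝ → Ker}

lemma condensateEq_iff_evPhi (hv : ∀ x, v (-x) = v x) (hφ : ∀ t ∈ I, MemLp (φ t) 2 volume)
    (hk : ∀ t ∈ I, IsPairKernel (k t)) :
    CondensateEq I (vN v β N) N φ k ↔
      EvPhi I (vN v β N) φ (fun t => Lam N (φ t) (k t)) (fun t => Gam N (φ t) (k t)) := by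
  refine and_congr_right fun _ => forall₂_congr fun t ht => forall_congr' fun x => ?_
  have h := isMeanField hv β N (hφ t ht) (hk t ht)
  have e := h.condensate_interaction (comp_sh_conjK_sh (hk t ht) N) x
  rw [h.phi_interaction, ← e, ← sub_eq_zero (b := -_)]
  refine Eq.congr_left ?_
  ring

lemma CondensateEq.Dt_sub_laplacian (hv : ∀ x, v (-x) = v x)
    (hφ : ∀ t ∈ I, MemLp (φ t) 2 volume) (hk : ∀ t ∈ I, IsPairKernel (k t))
    (hc : CondensateEq I (vN v β N) N φ k) {t : ℝ} (ht : t ∈ I) (x : E3) :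
    Dt I (fun τ => φ τ x) t - Laplacian.laplacian (φ t) x
      = -condensateForce (vN v β N) (1 / (2 * (N : ℂ))) (φ t) (sh (twice (k t)))
          (chReg (twice (k t))) (Gam N (φ t) (k t)) x := by
  rw [((condensateEq_iff_evPhi hv hφ hk).1 hc).2 t ht x,
    (isMeanField hv β N (hφ t ht) (hk t ht)).phi_interaction]

lemma pairEqS_iff_evLambda (hv : ∀ x, v (-x) = v x) (hN : 0 < N)
    (hφ : ∀ t ∈ I, MemLp (φ t) 2 volume) (hk : ∀ t ∈ I, IsPairKernel (k t))
    (hc : CondensateEq I (vN v β N) N φ k) :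
    PairEqS I (vN v β N) N φ k ↔
      EvLambda I (vN v β N) N φ (fun t => Lam N (φ t) (k t)) (fun t => Gam N (φ t) (k t)) := by
  have hN' : (N : ℂ) ≠ 0 := Nat.cast_ne_zero.2 hN.ne'
  have ha : (1 / (2 * (N : ℂ))) ≠ 0 := by simp [hN']
  have hD := hc.1.mul hc.1
  have hB : ∀ t ∈ I, ∀ x y, Lam N (φ t) (k t) x y
      = 1 / (2 * (N : ℂ)) * sh (twice (k t)) x y + φ t x * φ t y := fun _ _ _ _ => rfl
  refine Iff.trans (and_congr_right fun hu => ?_)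
    (and_congr_left' (regularKer_iff ha hD hB).symm)
  refine forall₂_congr fun t ht => forall₂_congr fun x y => ?_
  have h := isMeanField hv β N (hφ t ht) (hk t ht)
  have hx := hc.Dt_sub_laplacian hv hφ hk ht x
  have hy := hc.Dt_sub_laplacian hv hφ hk ht y
  rw [h.Lam_interaction, hu.Dt_add hD ht hB, Dt_mul (hc.1.1 t ht x) (hc.1.1 t ht y),
    lap₁_lin_comb (hu.2 t ht) (hc.1.2 t ht) (hB t ht),
    lap₂_lin_comb (hu.2 t ht) (hc.1.2 t ht) (hB t ht), ← sub_eq_zero (b := -_),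
    ← mul_right_inj' ha, mul_zero]
  refine Eq.congr_left ?_
  -- The deltas in `ch(2k)` and its conjugate contribute `wΛ` twice; scaled by `1/(2N)` they are the
  -- potential term `(1/N) wΛ`.
  have hc2 : 1 / (N : ℂ) = 2 * (1 / (2 * (N : ℂ))) := by field_simp
  have hw : potMul (vN v β N) (Lam N (φ t) (k t)) x y
      = (vN v β N (x - y) : ℂ) * Lam N (φ t) (k t) x y := rfl
  simp only [STilde, gTComp, compG, compDeltaAdd, deltaAddComp]
  rw [hc2, hw]
  linear_combination -φ t y * hx - φ t x * hy

lemma pairEqW_iff_evGamma (hv : ∀ x, v (-x) = v x) (hN : 0 < N)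
    (hφ : ∀ t ∈ I, MemLp (φ t) 2 volume) (hk : ∀ t ∈ I, IsPairKernel (k t))
    (hc : CondensateEq I (vN v β N) N φ k) :
    PairEqW I (vN v β N) N φ k ↔
      EvGamma I (vN v β N) φ (fun t => Lam N (φ t) (k t)) (fun t => Gam N (φ t) (k t)) := by
  have hN' : (N : ℂ) ≠ 0 := Nat.cast_ne_zero.2 hN.ne'
  have ha : (1 / (2 * (N : ℂ))) ≠ 0 := by simp [hN']
  have hD := hc.1.mul hc.1.conj
  have hB : ∀ t ∈ I, ∀ x y, conjK (Gam N (φ t) (k t)) x y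
      = 1 / (2 * (N : ℂ)) * conjK (chReg (twice (k t))) x y + φ t x * conj (φ t y) := by
    intro t ht x y
    have h := isMeanField hv β N (hφ t ht) (hk t ht)
    simp only [conjK, h.Gam_eq, map_add, map_mul, h.conj_const, Complex.conj_conj]
  refine Iff.trans (and_congr_right fun hu => ?_)
    (and_congr_left' (regularKer_iff ha hD hB).symm)
  refine forall₂_congr fun t ht => forall₂_congr fun x y => ?_
  have h := isMeanField hv β N (hφ t ht) (hk t ht)
  have hx := hc.Dt_sub_laplacian hv hφ hk ht x
  have hy := congrArg conj (hc.Dt_sub_laplacian hv hφ hk ht y)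
  rw [map_sub, map_neg] at hy
  have ht' := hu.Dt_add hD ht hB x y
  rw [Dt_mul (hc.1.1 t ht x) (hc.1.conj.1 t ht y), Dt_conj] at ht'
  simp only [conjK] at ht'
  rw [h.Gam_interaction, ht', lap₁_lin_comb (hu.2 t ht) (hc.1.2 t ht) (hB t ht),
    lap₂_lin_comb (hu.2 t ht) (hc.1.conj.2 t ht) (hB t ht), laplacian_conj,
    ← sub_eq_zero (b := -_), ← mul_right_inj' ha, mul_zero]
  refine Eq.congr_left ?_
  simp only [WTilde, gTComp, compGT, conjK]
  -- The product rule for `φ(x) φ̄(y)` uses the condensate equation at `x` and its conjugate at `y`,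
  -- with opposite signs.
  linear_combination -conj (φ t y) * hx + φ t x * hy

end Equivalence

end

end PairExcitation

theorem mainTheorem6 (v : 𝓢(E3, ℝ)) (hv_even : ∀ x, v (-x) = v x)
    (β : ℝ) (N : ℕ) (hN : 0 < N)
    (I : Set ℝ) (hI : I.OrdConnected) (hI_nontrivial : I.Nontrivial)
    (φ : ℝ → E3 → ℂ) (hφ : ∀ t ∈ I, MemLp (φ t) 2 volume)
    (k : ℝ → Ker) (hk : ∀ t ∈ I, IsPairKernel (k t)) :
    (CondensateEq I (vN v β N) N φ k ∧ PairEqS I (vN v β N) N φ k ∧ PairEqW I (vN v β N) N φ k)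
      ↔
    (EvPhi I (vN v β N) φ (fun t => Lam N (φ t) (k t)) (fun t => Gam N (φ t) (k t)) ∧
      EvLambda I (vN v β N) N φ (fun t => Lam N (φ t) (k t)) (fun t => Gam N (φ t) (k t)) ∧
      EvGamma I (vN v β N) φ (fun t => Lam N (φ t) (k t)) (fun t => Gam N (φ t) (k t))) := by
  have h1 := condensateEq_iff_evPhi (β := β) (N := N) hv_even hφ hk
  constructor
  · rintro ⟨hc, hS, hW⟩
    exact ⟨h1.1 hc, (pairEqS_iff_evLambda hv_even hN hφ hk hc).1 hS,
      (pairEqW_iff_evGamma hv_even hN hφ hk hc).1 hW⟩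
  · rintro ⟨hc, hL, hG⟩
    exact ⟨h1.2 hc, (pairEqS_iff_evLambda hv_even hN hφ hk (h1.2 hc)).2 hL,
      (pairEqW_iff_evGamma hv_even hN hφ hk (h1.2 hc)).2 hG⟩
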